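/- An instance of online bipartite matching is a finite bipartite graph $G(S\cup R,E)$ whose servers $S$ are known in advance, together with an arrival order of the requests $R$. The algorithm Ranking first gives every server $s\in S$ an independent rank $y_s$, uniform in $[0,1]$; then each arriving request is irrevocably matched to its currently unmatched neighbour of smallest rank, and stays unmatched if it has no unmatched neighbour. Let $\mathsf{ALG}$ be the size of the resulting matching and $\mathsf{OPT}$ the size of a maximum matching of $G$. The competitive ratio of Ranking on $d$-regular graphs is the infimum of $\mathbb{E}[\mathsf{ALG}]/\mathsf{OPT}$ over all online instances with $\mathsf{OPT}>0$ in which every server and every request has degree exactly $d$. Corollary. There is a $d_0$ such that for every $d\ge d_0$ the competitive ratio of Ranking on $d$-regular graphs is at most $0.8161$. Moreover, $$\gamma(d)=1-\frac{d-1}{2d-1}\left(1-\frac1d\right)^d$$ satisfies $\gamma(d)\to 1-\frac{1}{2e}$ as $d\to\infty$. -/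

import Mathlib

open Filter Topology MeasureTheory

/-- An instance of online bipartite matching. The servers are `0, …, n - 1` (known offline), the
requests are `0, …, m - 1` and arrive in this order; `nbr r` is the set of servers adjacent to the
request `r`, which is revealed when `r` arrives. -/
structure OnlineInstance where
  n : ℕ
  m : ℕ
  nbr : Fin m → Finset (Fin n)

namespace OnlineInstance

/-- The graph is `d`-regular: all requests and all servers have degree exactly `d`. -/
def IsRegular (I : OnlineInstance) (d : ℕ) : Prop :=
  (∀ r : Fin I.m, (I.nbr r).card = d) ∧
    ∀ s : Fin I.n, (Finset.univ.filter fun r : Fin I.m => s ∈ I.nbr r).card = d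

/-- A set of (request, server) pairs is a matching: its members are edges of the graph, and no two
different members share an endpoint. -/
def IsMatching (I : OnlineInstance) (M : Finset (Fin I.m × Fin I.n)) : Prop :=
  (∀ e ∈ M, e.2 ∈ I.nbr e.1) ∧ ∀ e ∈ M, ∀ f ∈ M, e.1 = f.1 ∨ e.2 = f.2 → e = f

open Classical in
/-- `OPT`: the size of a maximum matching in hindsight. -/
noncomputable def opt (I : OnlineInstance) : ℕ :=
  (Finset.univ.filter fun M : Finset (Fin I.m × Fin I.n) => I.IsMatching M).sup Finset.card

/-- The members of `A` of smallest rank (a single server unless there is a tie). -/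
noncomputable def minRank {n : ℕ} (y : Fin n → unitInterval) (A : Finset (Fin n)) :
    Finset (Fin n) :=
  A.filter fun s => ∀ t ∈ A, y s ≤ y t

/-- The neighbours of `r` that are not matched by `M`. -/
def available (I : OnlineInstance) (M : Finset (Fin I.m × Fin I.n)) (r : Fin I.m) :
    Finset (Fin I.n) :=
  I.nbr r \ M.image Prod.snd

/-- One step of Ranking: the arriving request `r` is matched to its unmatched neighbour of smallest
rank, if it has an unmatched neighbour. Ties (an event of probability zero) are resolved in favour
of the smallest index. -/
noncomputable def rankingStep (I : OnlineInstance) (y : Fin I.n → unitInterval)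
    (M : Finset (Fin I.m × Fin I.n)) (r : Fin I.m) : Finset (Fin I.m × Fin I.n) :=
  if h : (minRank y (I.available M r)).Nonempty then
    insert (r, (minRank y (I.available M r)).min' h) M
  else M

/-- The matching that Ranking computes when the servers have the ranks `y`; the requests are
processed in their order of arrival. -/
noncomputable def rankingMatching (I : OnlineInstance) (y : Fin I.n → unitInterval) :
    Finset (Fin I.m × Fin I.n) :=
  (List.finRange I.m).foldl (I.rankingStep y) ∅

/-- `E[ALG]`: the expected size of the matching that Ranking computes when the ranks of the servers
are independent and uniform in `[0,1]` (`volume` is the product of the uniform measures). -/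
noncomputable def expectedRanking (I : OnlineInstance) : ℝ :=
  ∫ y : Fin I.n → unitInterval, ((I.rankingMatching y).card : ℝ)

/-- The random variable in `expectedRanking` is determined by the order pattern of the ranks. -/
theorem rankingMatching_congr (I : OnlineInstance) {y z : Fin I.n → unitInterval}
    (h : ∀ s t, y s ≤ y t ↔ z s ≤ z t) : I.rankingMatching y = I.rankingMatching z := by
  have h1 : ∀ A, minRank y A = minRank z A := fun A => by
    simp only [minRank, h]
  have h2 : I.rankingStep y = I.rankingStep z := by
    funext M r
    simp only [rankingStep, h1]
  simp only [rankingMatching, h2]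

/-- The random variable in `expectedRanking` is measurable. -/
theorem measurable_ranking (I : OnlineInstance) :
    Measurable fun y : Fin I.n → unitInterval => ((I.rankingMatching y).card : ℝ) := by
  classical
  let p : (Fin I.n → unitInterval) → (Fin I.n → Fin I.n → Bool) :=
    fun y s t => decide (y s ≤ y t)
  have hp : Measurable p := by
    refine measurable_pi_lambda _ fun s => measurable_pi_lambda _ fun t => ?_
    refine measurable_to_bool ?_
    have : (fun y : Fin I.n → unitInterval => decide (y s ≤ y t)) ⁻¹' {true}
        = {y | y s ≤ y t} := by
      ext y; simp
    rw [this]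
    exact measurableSet_le (measurable_pi_apply s) (measurable_pi_apply t)
  have hf : Function.FactorsThrough
      (fun y : Fin I.n → unitInterval => ((I.rankingMatching y).card : ℝ)) p := by
    intro y z hyz
    have : I.rankingMatching y = I.rankingMatching z :=
      I.rankingMatching_congr fun s t => by
        simpa [p] using congrFun (congrFun hyz s) t
    simp only [this]
  rw [← hf.extend_comp (fun _ => 0)]
  exact (measurable_of_finite _).comp hp

/-- The random variable in `expectedRanking` is integrable. -/
theorem integrable_ranking (I : OnlineInstance) :
    Integrable fun y : Fin I.n → unitInterval => ((I.rankingMatching y).card : ℝ) := by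
  refine Integrable.of_bound I.measurable_ranking.aestronglyMeasurable
    (Fintype.card (Fin I.m × Fin I.n) : ℝ) (ae_of_all _ fun y => ?_)
  rw [Real.norm_of_nonneg (Nat.cast_nonneg _)]
  exact_mod_cast Finset.card_le_univ _

end OnlineInstance

/-- The values `E[ALG] / OPT` of Ranking on the online instances whose graph is `d`-regular. (The
quotient is meaningful only for `OPT > 0`, which for `d ≥ 1` excludes just the empty graph.) -/
def rankingRatios (d : ℕ) : Set ℝ :=
  {x | ∃ I : OnlineInstance, I.IsRegular d ∧ 0 < I.opt ∧ x = I.expectedRanking / I.opt}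

/-- The competitive ratio of Ranking on `d`-regular graphs: the infimum of `E[ALG] / OPT` over all
online instances. -/
noncomputable def rankingCompetitiveRatio (d : ℕ) : ℝ :=
  sInf (rankingRatios d)

/-- The infimum in `rankingCompetitiveRatio` is a genuine one for every `d ≥ 1`. -/
theorem isGLB_rankingCompetitiveRatio {d : ℕ} (hd : 1 ≤ d) :
    IsGLB (rankingRatios d) (rankingCompetitiveRatio d) := by
  classical
  refine isGLB_csInf ?_ ⟨0, ?_⟩
  · let I : OnlineInstance := ⟨d, d, fun _ => Finset.univ⟩
    refine ⟨_, I, ⟨fun r => by simp [I], fun s => by simp [I]⟩, ?_, rfl⟩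
    let M : Finset (Fin I.m × Fin I.n) := {((⟨0, hd⟩ : Fin d), (⟨0, hd⟩ : Fin d))}
    have hM : I.IsMatching M := by
      refine ⟨fun e _ => Finset.mem_univ _, fun e he f hf _ => ?_⟩
      rw [Finset.mem_singleton.mp he, Finset.mem_singleton.mp hf]
    have : M.card ≤ I.opt :=
      Finset.le_sup (f := Finset.card) (Finset.mem_filter.mpr ⟨Finset.mem_univ M, hM⟩)
    exact lt_of_lt_of_le (by simp [M]) this
  · rintro x ⟨I, -, -, rfl⟩
    exact div_nonneg (integral_nonneg fun y => Nat.cast_nonneg _) (Nat.cast_nonneg _)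

/-!
On the instances below, Ranking behaves like a water-filling algorithm that is led astray.

A gadget has `d - K` shared servers, `q + 1` clusters of `K` servers each, and `d` requests, where
`K = 2000` is a constant and `q = d / 2000`. All requests of the gadget are adjacent to all shared
servers, and each of them to one cluster in addition. In round `0`, somewhat more than `d / 2`
requests come with cluster `0`. They consume the servers of lowest rank among the `d` servers that
they see, so that with high probability the available shared servers all have rank at least `1 / 2`
afterwards (`OnlineInstance.le_rank_of_matched_late`). Each of the following `q` rounds has
`k = 900` requests and a fresh cluster, which with probability at least `0.95` has at least `k`
servers of rank below `1 / 2`; then all requests of the round are matched inside the cluster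
(`OnlineInstance.rank_lt_of_matched_round`). So after the rounds more than `0.4 d` of the
shared servers are unmatched in expectation, while all their edges are used up, and this is a loss
of more than a fifth of the at most `2 d` servers (`OnlineInstance.card_matched_le`,
`RoundInstance.expectedRanking_add_le`).

The servers in the clusters do not have degree `d` yet. Therefore `d` copies of the gadget are taken,
and afterwards padding requests arrive, each of which is adjacent to the `d` copies of one server in
a cluster. This makes the graph `d`-regular (`RoundInstance.isRegular_roundInstance`) and does not
touch the shared servers. By Hall's theorem a regular graph has a perfect matching
(`OnlineInstance.IsRegular.n_le_opt`), so `OPT` is the number of servers.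

About Ranking itself only two facts are used: its result is a matching, and it is stable for the
preferences given by the ranks and the arrival order (`OnlineInstance.rankingMatching_stable`). The
numbers of servers of low rank are controlled by Chebyshev's inequality
(`volume_lowRank_dev_le`).
-/

/-! ### Ranking computes a stable matching -/

namespace OnlineInstance

theorem mem_minRank {n : ℕ} {y : Fin n → unitInterval} {A : Finset (Fin n)} {s : Fin n} :
    s ∈ minRank y A ↔ s ∈ A ∧ ∀ t ∈ A, y s ≤ y t := by
  simp [minRank]

theorem mem_available {I : OnlineInstance} {M : Finset (Fin I.m × Fin I.n)} {r : Fin I.m}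
    {s : Fin I.n} : s ∈ I.available M r ↔ s ∈ I.nbr r ∧ ∀ r', (r', s) ∉ M := by
  simp [available]

theorem minRank_nonempty {n : ℕ} {y : Fin n → unitInterval} {A : Finset (Fin n)}
    (hA : A.Nonempty) : (minRank y A).Nonempty := by
  obtain ⟨s, hs, h⟩ := A.exists_min_image y hA
  exact ⟨s, mem_minRank.2 ⟨hs, h⟩⟩

/-- A step of Ranking either adds a pair `(r, s)` with `s` available of smallest rank, or leaves the
matching unchanged because no neighbour of `r` is available. -/
theorem rankingStep_cases (I : OnlineInstance) (y : Fin I.n → unitInterval)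
    (M : Finset (Fin I.m × Fin I.n)) (r : Fin I.m) :
    (∃ s ∈ I.available M r, (∀ t ∈ I.available M r, y s ≤ y t) ∧
      I.rankingStep y M r = insert (r, s) M) ∨
    (I.available M r = ∅ ∧ I.rankingStep y M r = M) := by
  by_cases h : (minRank y (I.available M r)).Nonempty
  · left
    have hm := mem_minRank.1 (Finset.min'_mem _ h)
    exact ⟨_, hm.1, hm.2, by rw [rankingStep, dif_pos h]⟩
  · right
    refine ⟨?_, by rw [rankingStep, dif_neg h]⟩
    by_contra hne
    exact h (minRank_nonempty (Finset.nonempty_iff_ne_empty.2 hne))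

/-- `M` is what Ranking may have produced after the requests in `l`: a matching of these requests
that is stable, in the sense that a neighbour `s` of `r ∈ l` was taken before `r` arrived unless `r`
is matched to a server of rank at most `y s`. -/
structure IsStable (I : OnlineInstance) (y : Fin I.n → unitInterval) (l : List (Fin I.m))
    (M : Finset (Fin I.m × Fin I.n)) : Prop where
  matching : I.IsMatching M
  fst_mem : ∀ e ∈ M, e.1 ∈ l
  stable : ∀ r ∈ l, ∀ s ∈ I.nbr r,
    (∃ r' < r, (r', s) ∈ M) ∨ ∃ s', (r, s') ∈ M ∧ y s' ≤ y s

theorem isStable_foldl (I : OnlineInstance) (y : Fin I.n → unitInterval) (l : List (Fin I.m))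
    (hl : l.Pairwise (· < ·)) : I.IsStable y l (l.foldl (I.rankingStep y) ∅) := by
  induction l using List.reverseRecOn with
  | nil => exact ⟨⟨by simp, by simp⟩, by simp, by simp⟩
  | append_singleton l a ih =>
    rw [List.pairwise_append] at hl
    obtain ⟨hl1, -, hla⟩ := hl
    have hla : ∀ r ∈ l, r < a := fun r hr => hla r hr a (by simp)
    obtain ⟨⟨hM1, hM2⟩, hfst, hst⟩ := ih hl1
    rw [List.foldl_append, List.foldl_cons, List.foldl_nil]
    set M := l.foldl (I.rankingStep y) ∅
    rcases I.rankingStep_cases y M a with ⟨s, hs, hmin, heq⟩ | ⟨hempty, heq⟩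
    · rw [heq]
      rw [mem_available] at hs
      have hnew : ∀ e ∈ M, ¬ (e.1 = a ∨ e.2 = s) := by
        rintro ⟨e1, e2⟩ he (h | h)
        · exact (hla _ (hfst _ he)).ne h
        · simp only at h
          exact hs.2 e1 (h ▸ he)
      refine ⟨⟨?_, ?_⟩, ?_, ?_⟩
      · intro e he
        rcases Finset.mem_insert.1 he with rfl | he
        · exact hs.1
        · exact hM1 e he
      · intro e he f hf h
        rcases Finset.mem_insert.1 he with rfl | he <;> rcases Finset.mem_insert.1 hf with rfl | hf
        · rfl
        · exact absurd (h.imp Eq.symm Eq.symm) (hnew f hf)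
        · exact absurd h (hnew e he)
        · exact hM2 e he f hf h
      · intro e he
        rcases Finset.mem_insert.1 he with rfl | he
        · simp
        · exact List.mem_append_left _ (hfst e he)
      · intro r hr t ht
        rcases List.mem_append.1 hr with hr | hr
        · rcases hst r hr t ht with ⟨r', h1, h2⟩ | ⟨s', h1, h2⟩
          · exact .inl ⟨r', h1, Finset.mem_insert_of_mem h2⟩
          · exact .inr ⟨s', Finset.mem_insert_of_mem h1, h2⟩
        · obtain rfl : r = a := by simpa using hr
          by_cases hav : t ∈ I.available M r
          · exact .inr ⟨s, Finset.mem_insert_self _ _, hmin t hav⟩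
          · simp only [mem_available, not_and, not_forall, not_not] at hav
            obtain ⟨r', hr'⟩ := hav ht
            exact .inl ⟨r', hla _ (hfst _ hr'), Finset.mem_insert_of_mem hr'⟩
    · rw [heq]
      refine ⟨⟨hM1, hM2⟩, fun e he => List.mem_append_left _ (hfst e he), ?_⟩
      intro r hr t ht
      rcases List.mem_append.1 hr with hr | hr
      · exact hst r hr t ht
      · obtain rfl : r = a := by simpa using hr
        have hav : t ∉ I.available M r := by simp [hempty]
        simp only [mem_available, not_and, not_forall, not_not] at hav
        obtain ⟨r', hr'⟩ := hav ht
        exact .inl ⟨r', hla _ (hfst _ hr'), hr'⟩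

theorem isMatching_rankingMatching (I : OnlineInstance) (y : Fin I.n → unitInterval) :
    I.IsMatching (I.rankingMatching y) :=
  (I.isStable_foldl y _ (List.pairwise_lt_finRange _)).matching

theorem rankingMatching_stable (I : OnlineInstance) (y : Fin I.n → unitInterval) {r : Fin I.m}
    {s : Fin I.n} (hs : s ∈ I.nbr r) :
    (∃ r' < r, (r', s) ∈ I.rankingMatching y) ∨
      ∃ s', (r, s') ∈ I.rankingMatching y ∧ y s' ≤ y s :=
  (I.isStable_foldl y _ (List.pairwise_lt_finRange _)).stable r (List.mem_finRange r) s hs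

/-! ### Perfect matchings of regular graphs -/

theorem IsMatching.card_le_opt {I : OnlineInstance} {M : Finset (Fin I.m × Fin I.n)}
    (hM : I.IsMatching M) : M.card ≤ I.opt := by
  classical
  exact Finset.le_sup (f := Finset.card) (Finset.mem_filter.mpr ⟨Finset.mem_univ M, hM⟩)

/-- By Hall's theorem a regular graph has a matching that covers all servers. -/
theorem IsRegular.n_le_opt {I : OnlineInstance} {d : ℕ} (hd : 0 < d) (hI : I.IsRegular d) :
    I.n ≤ I.opt := by
  classical
  let t : Fin I.n → Finset (Fin I.m) := fun s => Finset.univ.filter fun r => s ∈ I.nbr r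
  have hall : ∀ A : Finset (Fin I.n), A.card ≤ (A.biUnion t).card := by
    intro A
    -- double counting of the edges at `A`
    have h : A.card * d ≤ (A.biUnion t).card * d := by
      refine Finset.card_mul_le_card_mul (fun s r => s ∈ I.nbr r) (fun s hs => ?_) fun r _ => ?_
      · rw [← hI.2 s]
        refine Finset.card_le_card fun r hr => ?_
        rw [Finset.mem_bipartiteAbove]
        exact ⟨Finset.mem_biUnion.2 ⟨s, hs, hr⟩, (Finset.mem_filter.1 hr).2⟩
      · rw [← hI.1 r]
        exact Finset.card_le_card fun s hs => (Finset.mem_filter.1 hs).2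
    exact Nat.le_of_mul_le_mul_right h hd
  obtain ⟨f, hf, hft⟩ := (Finset.all_card_le_biUnion_card_iff_exists_injective t).1 hall
  have hM : I.IsMatching (Finset.univ.image fun s => (f s, s)) := by
    refine ⟨fun e he => ?_, fun e he e' he' h => ?_⟩
    · obtain ⟨s, -, rfl⟩ := Finset.mem_image.1 he
      exact (Finset.mem_filter.1 (hft s)).2
    · obtain ⟨s, -, rfl⟩ := Finset.mem_image.1 he
      obtain ⟨s', -, rfl⟩ := Finset.mem_image.1 he'
      have : s = s' := h.elim (fun h => hf h) id
      rw [this]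
  refine le_trans (le_of_eq ?_) hM.card_le_opt
  rw [Finset.card_image_of_injective _ fun a b h => congrArg Prod.snd h, Finset.card_univ,
    Fintype.card_fin]

end OnlineInstance

/-! ### Servers of low rank and the shared servers consumed in rounds -/

/-- The members of `T` of rank below `θ`. -/
noncomputable def lowRank {n : ℕ} (θ : unitInterval) (y : Fin n → unitInterval) (T : Finset (Fin n)) :
    Finset (Fin n) :=
  T.filter fun s => y s < θ

theorem mem_lowRank {n : ℕ} {θ : unitInterval} {y : Fin n → unitInterval} {T : Finset (Fin n)}
    {s : Fin n} : s ∈ lowRank θ y T ↔ s ∈ T ∧ y s < θ := by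
  simp [lowRank]

namespace OnlineInstance

/-- If all requests in `T₀` are adjacent exactly to `D`, and `w ∈ D` is matched to a request
that arrives after all of them, then each request in `T₀` is matched inside `D` to a server that
beats `w`. So `w` has rank at least `θ` unless `D` has more than `|T₀|` servers of rank below `θ`. -/
theorem le_rank_of_matched_late (I : OnlineInstance) (y : Fin I.n → unitInterval)
    (θ : unitInterval) {D : Finset (Fin I.n)} {T₀ : Finset (Fin I.m)}
    (hT : ∀ r ∈ T₀, I.nbr r = D) (hlow : (lowRank θ y D).card ≤ T₀.card) {r : Fin I.m}
    (hr : ∀ r' ∈ T₀, r' < r) {w : Fin I.n} (hw : w ∈ D) (hrw : (r, w) ∈ I.rankingMatching y) :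
    θ ≤ y w := by
  classical
  obtain ⟨hM1, hM2⟩ := I.isMatching_rankingMatching y
  by_contra! hlt
  have hex : ∀ r' ∈ T₀, ∃ s ∈ (lowRank θ y D).erase w, (r', s) ∈ I.rankingMatching y := by
    intro r' hr'
    rcases I.rankingMatching_stable y (r := r') (s := w) (by rwa [hT r' hr']) with
      ⟨r'', hr'', hm⟩ | ⟨s, hm, hs⟩
    · have := hM2 _ hm _ hrw (.inr rfl)
      have hrr : r'' = r := congrArg Prod.fst this
      exact absurd (hr''.trans (hr r' hr')) (by simp [hrr])
    · refine ⟨s, Finset.mem_erase.2 ⟨?_, mem_lowRank.2 ⟨?_, hs.trans_lt hlt⟩⟩, hm⟩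
      · rintro rfl
        have := hM2 _ hm _ hrw (.inr rfl)
        exact (hr r' hr').ne (congrArg Prod.fst this)
      · rw [← hT r' hr']
        exact hM1 _ hm
  have h1 : T₀.card ≤ ((lowRank θ y D).erase w).card := by
    refine Finset.card_le_card_of_forall_subsingleton
      (fun r s => (r, s) ∈ I.rankingMatching y) hex fun s _ a ha b hb => ?_
    exact congrArg Prod.fst (hM2 _ ha.2 _ hb.2 (.inr rfl))
  have h2 := Finset.card_erase_lt_of_mem (mem_lowRank.2 ⟨hw, hlt⟩ : w ∈ lowRank θ y D)
  omega

/-- Suppose that before the end of the round `T` only requests of `T` are adjacent to `C`, and that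
`C` has at least `|T|` servers of rank below `θ`. Then such a server is available for each request
of the round, which is therefore matched to a server of rank below `θ`. -/
theorem rank_lt_of_matched_round (I : OnlineInstance) (y : Fin I.n → unitInterval)
    (θ : unitInterval) {C : Finset (Fin I.n)} {T : Finset (Fin I.m)}
    (hT : ∀ r ∈ T, C ⊆ I.nbr r) {r : Fin I.m} (hr : r ∈ T)
    (hC : ∀ r' < r, r' ∉ T → Disjoint (I.nbr r') C)
    (hlow : T.card ≤ (lowRank θ y C).card) {w : Fin I.n}
    (hrw : (r, w) ∈ I.rankingMatching y) : y w < θ := by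
  classical
  obtain ⟨hM1, hM2⟩ := I.isMatching_rankingMatching y
  by_contra! hle
  have hex : ∀ s ∈ lowRank θ y C, ∃ r' ∈ T.erase r, (r', s) ∈ I.rankingMatching y := by
    intro s hs
    rw [mem_lowRank] at hs
    rcases I.rankingMatching_stable y (hT r hr hs.1) with ⟨r', hr', hm⟩ | ⟨s', hm, hs'⟩
    · refine ⟨r', Finset.mem_erase.2 ⟨hr'.ne, ?_⟩, hm⟩
      by_contra hne
      exact Finset.disjoint_left.1 (hC r' hr' hne) (hM1 _ hm) hs.1
    · have := hM2 _ hm _ hrw (.inl rfl)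
      have hsw : s' = w := congrArg Prod.snd this
      subst hsw
      exact absurd (hs'.trans_lt hs.2) (not_lt.2 hle)
  have h1 : (lowRank θ y C).card ≤ (T.erase r).card := by
    refine Finset.card_le_card_of_forall_subsingleton
      (fun s r => (r, s) ∈ I.rankingMatching y) hex fun r' _ a ha b hb => ?_
    exact congrArg Prod.snd (hM2 _ ha.2 _ hb.2 (.inl rfl))
  have h2 := Finset.card_erase_lt_of_mem hr
  omega

/-- Let the requests adjacent to `W` arrive in rounds `T j`, round `j` being adjacent to `W ∪ C j`,
with round `j₀` first. If few servers of `W ∪ C j₀` have rank below `θ`, they are all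
consumed in round `j₀`, and then a round `j ≠ j₀` takes nothing from `W` if sufficiently many
servers of `C j` have rank below `θ`. The last two terms account for the failure of these
conditions. -/
theorem card_matched_le (I : OnlineInstance) (y : Fin I.n → unitInterval) (θ : unitInterval)
    {ι : Type*} [Fintype ι] [DecidableEq ι] (j₀ : ι) {W : Finset (Fin I.n)}
    {C : ι → Finset (Fin I.n)} {T : ι → Finset (Fin I.m)} {k : ℕ}
    (hT : ∀ j, ∀ r ∈ T j, I.nbr r = W ∪ C j)
    (hW : ∀ r, (∀ j, r ∉ T j) → Disjoint (I.nbr r) W)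
    (hC : ∀ j, ∀ r ∈ T j, ∀ r' < r, r' ∉ T j → Disjoint (I.nbr r') (C j))
    (h₀ : ∀ j ≠ j₀, ∀ r ∈ T j₀, ∀ r' ∈ T j, r < r')
    (hk : ∀ j ≠ j₀, (T j).card = k) :
    (W ∩ (I.rankingMatching y).image Prod.snd).card ≤ (T j₀).card +
      (if (T j₀).card < (lowRank θ y (W ∪ C j₀)).card then ∑ j, (T j).card else 0) +
      ∑ j ∈ Finset.univ.erase j₀, if (lowRank θ y (C j)).card < k then k else 0 := by
  classical
  obtain ⟨hM1, hM2⟩ := I.isMatching_rankingMatching y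
  set U : Finset (Fin I.m) := T j₀ ∪
    (if (T j₀).card < (lowRank θ y (W ∪ C j₀)).card then Finset.univ.biUnion T else ∅) ∪
    (Finset.univ.erase j₀).biUnion fun j => if (lowRank θ y (C j)).card < k then T j else ∅
    with hU
  have h1 : (W ∩ (I.rankingMatching y).image Prod.snd).card ≤ U.card := by
    refine Finset.card_le_card_of_forall_subsingleton
      (fun s r => (r, s) ∈ I.rankingMatching y) (fun w hw => ?_) fun r' _ a ha b hb =>
        congrArg Prod.snd (hM2 _ ha.2 _ hb.2 (.inl rfl))
    obtain ⟨hw, hwM⟩ := Finset.mem_inter.1 hw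
    obtain ⟨⟨r, w'⟩, hrw, rfl⟩ := Finset.mem_image.1 hwM
    refine ⟨r, ?_, hrw⟩
    obtain ⟨j, hj⟩ : ∃ j, r ∈ T j := by
      by_contra! h
      exact Finset.disjoint_left.1 (hW r h) (hM1 _ hrw) hw
    by_cases hj0 : j = j₀
    · subst hj0
      simp [hU, hj]
    by_cases hbad : (T j₀).card < (lowRank θ y (W ∪ C j₀)).card
    · have : r ∈ Finset.univ.biUnion T := Finset.mem_biUnion.2 ⟨j, Finset.mem_univ _, hj⟩
      rw [hU, if_pos hbad]
      exact Finset.mem_union_left _ (Finset.mem_union_right _ this)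
    have hge : θ ≤ y w' := I.le_rank_of_matched_late y θ (hT j₀) (not_lt.1 hbad)
      (fun r' hr' => h₀ j hj0 r' hr' r hj) (Finset.mem_union_left _ hw) hrw
    have hbadj : (lowRank θ y (C j)).card < k := by
      by_contra! hgood
      refine absurd (I.rank_lt_of_matched_round y θ (C := C j) (fun r hr => ?_) hj (hC j r hj)
        (by rwa [hk j hj0]) hrw) (not_lt.2 hge)
      rw [hT j r hr]
      exact Finset.subset_union_right
    refine Finset.mem_union_right _ (Finset.mem_biUnion.2 ⟨j, by simp [hj0], ?_⟩)
    rwa [if_pos hbadj]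
  refine h1.trans ((Finset.card_union_le _ _).trans (add_le_add ((Finset.card_union_le _ _).trans
    (add_le_add le_rfl ?_)) (Finset.card_biUnion_le.trans (Finset.sum_le_sum fun j hj => ?_))))
  · split_ifs
    · exact Finset.card_biUnion_le
    · simp
  · split_ifs
    · exact (hk j (Finset.ne_of_mem_erase hj)).le
    · simp

end OnlineInstance

/-! ### Concentration of the number of servers of low rank -/

/-- Chebyshev's inequality for the number of servers in `T` of rank below `θ`, which is binomially
distributed. -/
theorem volume_lowRank_dev_le {n : ℕ} (θ : unitInterval) (T : Finset (Fin n)) {t : ℝ} (ht : 0 < t) :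
    volume.real {y : Fin n → unitInterval | t ≤ |((lowRank θ y T).card : ℝ) - θ * T.card|} ≤
      T.card / (4 * t ^ 2) := by
  classical
  -- the indicator of the event that the server `s` counts
  let X : Fin n → unitInterval → ℝ := fun s =>
    if s ∈ T then Set.indicator (Set.Iio θ) 1 else 0
  have hXm : ∀ s, Measurable (X s) := by
    intro s
    by_cases hs : s ∈ T
    · simpa [X, hs] using measurable_one.indicator measurableSet_Iio
    · simpa [X, hs] using measurable_zero
  have hXb : ∀ s x, X s x ∈ Set.Icc (0 : ℝ) 1 := by
    intro s x
    by_cases hs : s ∈ T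
    · by_cases hx : x < θ <;> simp [X, hs, hx]
    · simp [X, hs]
  have hXL : ∀ s, MemLp (X s) 2 (volume : Measure unitInterval) := fun s =>
    MemLp.of_bound (hXm s).aestronglyMeasurable 1 (ae_of_all _ fun x => by
      rw [Real.norm_of_nonneg (hXb s x).1]
      exact (hXb s x).2)
  have hXint : ∀ s, ∫ x, X s x = if s ∈ T then (θ : ℝ) else 0 := by
    intro s
    by_cases hs : s ∈ T
    · simp only [X, hs, if_true]
      rw [integral_indicator_one measurableSet_Iio, measureReal_def, unitInterval.volume_Iio,
        ENNReal.toReal_ofReal θ.2.1]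
    · simp [X, hs]
  let Y : (Fin n → unitInterval) → ℝ := ∑ s, fun y => X s (y s)
  have hY : ∀ y, Y y = (lowRank θ y T).card := by
    intro y
    have : ∀ s, X s (y s) = if s ∈ lowRank θ y T then 1 else 0 := by
      intro s
      by_cases hs : s ∈ T <;> by_cases hx : y s < θ <;> simp [X, hs, hx, mem_lowRank]
    simp only [Y, Finset.sum_apply, this]
    simp
  have hYL : ∀ s, MemLp (fun y : Fin n → unitInterval => X s (y s)) 2 volume := fun s =>
    (hXL s).comp_measurePreserving (measurePreserving_eval (fun _ => volume) s)
  have hYL' : MemLp Y 2 volume := memLp_finsetSum' _ fun s _ => hYL s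
  have hmean : ∫ y, Y y = θ * T.card := by
    have h1 : ∀ y, Y y = ∑ s, X s (y s) := fun y => by simp [Y]
    simp only [h1]
    rw [integral_finsetSum _ fun s _ => (hYL s).integrable one_le_two]
    have h2 : ∀ s, ∫ y : Fin n → unitInterval, X s (y s) = if s ∈ T then (θ : ℝ) else 0 := by
      intro s
      rw [← hXint s]
      exact integral_comp_eval (μ := fun _ => volume) (hXm s).aestronglyMeasurable
    simp only [h2]
    simp [mul_comm]
  have hvar : ProbabilityTheory.variance Y volume ≤ T.card / 4 := by
    have h1 : ProbabilityTheory.variance Y volume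
        = ∑ s, ProbabilityTheory.variance (X s) volume :=
      ProbabilityTheory.variance_sum_pi hXL
    have h2 : ∀ s, ProbabilityTheory.variance (X s) volume ≤ if s ∈ T then 1 / 4 else 0 := by
      intro s
      by_cases hs : s ∈ T
      · rw [if_pos hs]
        refine (ProbabilityTheory.variance_le_sq_of_bounded (ae_of_all _ (hXb s))
          (hXm s).aemeasurable).trans (by norm_num)
      · have : X s = 0 := by simp [X, hs]
        simp [this, hs]
    rw [h1]
    refine (Finset.sum_le_sum fun s _ => h2 s).trans (le_of_eq ?_)
    simp [div_eq_mul_inv]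
  have hcheb := ProbabilityTheory.meas_ge_le_variance_div_sq hYL' ht
  rw [hmean] at hcheb
  simp only [hY] at hcheb
  have hnn : 0 ≤ ProbabilityTheory.variance Y volume / t ^ 2 :=
    div_nonneg (ProbabilityTheory.variance_nonneg _ _) (by positivity)
  rw [measureReal_def]
  refine (ENNReal.toReal_mono ENNReal.ofReal_ne_top hcheb).trans ?_
  rw [ENNReal.toReal_ofReal hnn]
  calc ProbabilityTheory.variance Y volume / t ^ 2 ≤ (T.card / 4) / t ^ 2 := by gcongr
    _ = T.card / (4 * t ^ 2) := by rw [div_div]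

theorem volume_lowRank_lt_le {n : ℕ} (θ : unitInterval) (T : Finset (Fin n)) {t : ℝ} (ht : 0 < t)
    {k : ℕ} (hk : k + t ≤ (θ : ℝ) * T.card) :
    volume.real {y : Fin n → unitInterval | (lowRank θ y T).card < k} ≤ T.card / (4 * t ^ 2) := by
  refine (measureReal_mono fun y hy => ?_).trans (volume_lowRank_dev_le θ T ht)
  have : ((lowRank θ y T).card : ℝ) < k := by exact_mod_cast hy
  rw [Set.mem_ofPred_eq, abs_sub_comm]
  exact le_trans (by linarith) (le_abs_self _)

theorem volume_lt_lowRank_le {n : ℕ} (θ : unitInterval) (T : Finset (Fin n)) {t : ℝ} (ht : 0 < t)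
    {k : ℕ} (hk : (θ : ℝ) * T.card + t ≤ k) :
    volume.real {y : Fin n → unitInterval | k < (lowRank θ y T).card} ≤ T.card / (4 * t ^ 2) := by
  refine (measureReal_mono fun y hy => ?_).trans (volume_lowRank_dev_le θ T ht)
  have : (k : ℝ) < (lowRank θ y T).card := by exact_mod_cast hy
  rw [Set.mem_ofPred_eq]
  exact le_trans (by linarith) (le_abs_self _)

theorem measurableSet_lowRank {n : ℕ} (θ : unitInterval) (T : Finset (Fin n)) (P : ℕ → Prop) :
    MeasurableSet {y : Fin n → unitInterval | P (lowRank θ y T).card} := by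
  have hm : Measurable fun y : Fin n → unitInterval => (lowRank θ y T).card := by
    have : (fun y : Fin n → unitInterval => (lowRank θ y T).card) =
        fun y => ∑ s ∈ T, if y s < θ then 1 else 0 := by
      funext y
      simp [lowRank]
    rw [this]
    refine Finset.measurable_sum _ fun s _ => ?_
    exact Measurable.ite (measurableSet_lt (measurable_pi_apply s) measurable_const)
      measurable_const measurable_const
  exact hm (MeasurableSet.of_discrete (s := {m | P m}))

/-! ### The hard instance -/

namespace RoundInstance

/-- The servers: `d` copies of a gadget that consists of `d - K` shared servers and of `q + 1`
clusters of `K` servers each. -/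
abbrev Server (d K q : ℕ) : Type := Fin d × (Fin (d - K) ⊕ Fin (q + 1) × Fin K)

variable {d K q : ℕ} (f : Fin d → Fin (q + 1))

/-- The padding requests: each position in a cluster has as many of them as the degree of its
servers in the rounds falls short of `d`. Here `f` assigns to each of the `d` requests of a gadget
the round in which it takes part. -/
abbrev Padding (K : ℕ) (f : Fin d → Fin (q + 1)) : Type :=
  Σ p : Fin (q + 1) × Fin K, Fin (d - (Finset.univ.filter fun t => f t = p.1).card)

/-- The `t`-th request of copy `c` is adjacent to the shared servers and to the cluster `f t` of its
copy. -/
def roundNbr (x : Fin d × Fin d) : Finset (Server d K q) :=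
  {x.1} ×ˢ (Finset.univ.disjSum ({f x.2} ×ˢ Finset.univ))

/-- A padding request is adjacent to the `d` copies of its position. -/
def paddingNbr (x : Padding K f) : Finset (Server d K q) :=
  Finset.univ ×ˢ {Sum.inr x.1}

/-- The order of arrival: all requests of the rounds precede the padding requests, and within
each copy they arrive in their given order. -/
noncomputable def arrivalOrder (K : ℕ) (f : Fin d → Fin (q + 1)) :
    Fin d × Fin d ⊕ Padding K f ≃ Fin (d * d + Fintype.card (Padding K f)) :=
  (Equiv.sumCongr finProdFinEquiv (Fintype.equivFin _)).trans finSumFinEquiv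

/-- The online instance formed by these servers and requests. -/
noncomputable def roundInstance (K : ℕ) (f : Fin d → Fin (q + 1)) : OnlineInstance where
  n := Fintype.card (Server d K q)
  m := d * d + Fintype.card (Padding K f)
  nbr r := (Sum.elim (roundNbr f) (paddingNbr f) ((arrivalOrder K f).symm r)).map
    (Fintype.equivFin (Server d K q)).toEmbedding

/-- The indices of the requests in the online instance. -/
noncomputable def reqEquiv (K : ℕ) (f : Fin d → Fin (q + 1)) :
    Fin d × Fin d ⊕ Padding K f ≃ Fin (roundInstance K f).m :=
  arrivalOrder K f

/-- The indices of the servers in the online instance. -/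
noncomputable def serverEquiv (K : ℕ) (f : Fin d → Fin (q + 1)) :
    Server d K q ≃ Fin (roundInstance K f).n :=
  Fintype.equivFin (Server d K q)

/-- A set of servers as a set of indices of the online instance. -/
noncomputable def idx (A : Finset (Server d K q)) : Finset (Fin (roundInstance K f).n) :=
  A.map (serverEquiv K f).toEmbedding

theorem serverEquiv_mem_idx {A : Finset (Server d K q)} {s : Server d K q} :
    serverEquiv K f s ∈ idx f A ↔ s ∈ A := by
  simp [idx]

theorem card_idx (A : Finset (Server d K q)) : (idx f A).card = A.card := Finset.card_map _

theorem idx_union (A B : Finset (Server d K q)) : idx f (A ∪ B) = idx f A ∪ idx f B :=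
  Finset.map_union _ _

theorem disjoint_idx {A B : Finset (Server d K q)} :
    Disjoint (idx f A) (idx f B) ↔ Disjoint A B := Finset.disjoint_map _

theorem nbr_reqEquiv (x : Fin d × Fin d ⊕ Padding K f) : (roundInstance K f).nbr
    (reqEquiv K f x) = idx f (Sum.elim (roundNbr f) (paddingNbr f) x) := by
  change Finset.map _ (Sum.elim (roundNbr f) (paddingNbr f)
    ((arrivalOrder K f).symm (arrivalOrder K f x))) = _
  rw [Equiv.symm_apply_apply]
  rfl

theorem nbr_round (x : Fin d × Fin d) :
    (roundInstance K f).nbr (reqEquiv K f (Sum.inl x)) = idx f (roundNbr f x) :=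
  nbr_reqEquiv f (Sum.inl x)

theorem nbr_padding (x : Padding K f) :
    (roundInstance K f).nbr (reqEquiv K f (Sum.inr x)) = idx f (paddingNbr f x) :=
  nbr_reqEquiv f (Sum.inr x)

theorem round_lt_round {c t t' : Fin d} :
    reqEquiv K f (Sum.inl (c, t)) < reqEquiv K f (Sum.inl (c, t')) ↔ t < t' := by
  rw [Fin.lt_def, Fin.lt_def]
  change (finProdFinEquiv (c, t) : ℕ) < (finProdFinEquiv (c, t') : ℕ) ↔ _
  simp [finProdFinEquiv_apply_val]

theorem round_lt_padding (x : Fin d × Fin d) (z : Padding K f) :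
    reqEquiv K f (Sum.inl x) < reqEquiv K f (Sum.inr z) := by
  rw [Fin.lt_def]
  change (finProdFinEquiv x : ℕ) < d * d + (Fintype.equivFin _ z : ℕ)
  exact lt_of_lt_of_le (Fin.is_lt _) (Nat.le_add_right _ _)

theorem isRegular_roundInstance (hK : K ≤ d) : (roundInstance K f).IsRegular d := by
  classical
  refine ⟨fun r => ?_, fun s => ?_⟩
  · obtain ⟨x | x, rfl⟩ := (reqEquiv K f).surjective r
    · rw [nbr_round, card_idx]
      simp [roundNbr, hK]
    · rw [nbr_padding, card_idx]
      simp [paddingNbr]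
  · obtain ⟨⟨c, p⟩, rfl⟩ := (serverEquiv K f).surjective s
    have h1 : (Finset.univ.filter fun r : Fin (roundInstance K f).m =>
        serverEquiv K f (c, p) ∈ (roundInstance K f).nbr r).card =
        (Finset.univ.filter fun x : Fin d × Fin d ⊕ Padding K f =>
          (c, p) ∈ Sum.elim (roundNbr f) (paddingNbr f) x).card := by
      symm
      refine Finset.card_equiv (reqEquiv K f) fun x => ?_
      simp [nbr_reqEquiv, serverEquiv_mem_idx]
    rw [h1, Finset.card_filter, Fintype.sum_sum_type, Fintype.sum_prod_type, Fintype.sum_sigma]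
    rcases p with w | ⟨j, i⟩
    · simp [roundNbr, paddingNbr]
    · have h2 : ∀ x : Fin d, (∑ y : Fin d, if (c, (Sum.inr (j, i) : Fin (d - K) ⊕ _)) ∈
          roundNbr f (x, y) then 1 else 0) =
          if c = x then (Finset.univ.filter fun t => f t = j).card else 0 := by
        intro x
        by_cases hx : c = x
        · rw [if_pos hx, Finset.card_filter]
          refine Finset.sum_congr rfl fun t _ => ?_
          simp [roundNbr, hx, eq_comm]
        · simp [roundNbr, Ne.symm hx, hx]
      have h3 : ∀ p : Fin (q + 1) × Fin K,
          (∑ y : Fin (d - (Finset.univ.filter fun t => f t = p.1).card),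
            if (c, (Sum.inr (j, i) : Fin (d - K) ⊕ _)) ∈ paddingNbr f ⟨p, y⟩ then 1 else 0) =
          if (j, i) = p then d - (Finset.univ.filter fun t => f t = p.1).card else 0 := by
        intro p
        by_cases hp : (j, i) = p
        · simp [paddingNbr, hp]
        · simp [paddingNbr, Ne.symm hp, hp]
      refine (congrArg₂ (· + ·) (Finset.sum_congr rfl fun x _ => h2 x)
        (Finset.sum_congr rfl fun p _ => h3 p)).trans ?_
      rw [Finset.sum_ite_eq, Finset.sum_ite_eq, if_pos (Finset.mem_univ _),
        if_pos (Finset.mem_univ _)]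
      exact Nat.add_sub_cancel' ((Finset.card_le_univ _).trans_eq (Fintype.card_fin d))

/-- The shared servers of copy `c`. -/
def shared (K q : ℕ) (c : Fin d) : Finset (Server d K q) := {c} ×ˢ Finset.univ.disjSum ∅

/-- The cluster `j` of copy `c`. -/
def cluster (K : ℕ) (c : Fin d) (j : Fin (q + 1)) : Finset (Server d K q) :=
  {c} ×ˢ Finset.disjSum ∅ ({j} ×ˢ Finset.univ)

/-- The requests of copy `c` in round `j`. -/
noncomputable def round (K : ℕ) (f : Fin d → Fin (q + 1)) (c : Fin d) (j : Fin (q + 1)) :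
    Finset (Fin (roundInstance K f).m) :=
  (Finset.univ.filter fun t => f t = j).map
    ⟨fun t => reqEquiv K f (Sum.inl (c, t)), fun a b h => by
      simpa only [EmbeddingLike.apply_eq_iff_eq, Sum.inl.injEq, Prod.mk.injEq, true_and] using h⟩

theorem mem_round {c : Fin d} {j : Fin (q + 1)} {r : Fin (roundInstance K f).m} :
    r ∈ round K f c j ↔ ∃ t, f t = j ∧ reqEquiv K f (Sum.inl (c, t)) = r := by
  simp only [round, Finset.mem_map, Finset.mem_filter, Finset.mem_univ, true_and]
  rfl

theorem card_round (c : Fin d) (j : Fin (q + 1)) :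
    (round K f c j).card = (Finset.univ.filter fun t => f t = j).card := Finset.card_map _

theorem sum_card_round (c : Fin d) : ∑ j, (round K f c j).card = d := by
  simp only [card_round]
  rw [← Finset.card_eq_sum_card_fiberwise (fun _ _ => Finset.mem_coe.2 (Finset.mem_univ _))]
  simp

theorem card_shared (c : Fin d) : (shared K q c).card = d - K := by simp [shared]

theorem card_cluster (c : Fin d) (j : Fin (q + 1)) : (cluster K c j).card = K := by simp [cluster]

theorem card_shared_union_cluster (hK : K ≤ d) (c : Fin d) (j : Fin (q + 1)) :
    (shared K q c ∪ cluster K c j).card = d := by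
  rw [Finset.card_union_of_disjoint, card_shared, card_cluster, Nat.sub_add_cancel hK]
  rw [Finset.disjoint_left]
  rintro ⟨c', p | p⟩ h1 h2 <;> simp [shared, cluster] at h1 h2

theorem roundNbr_eq (c t : Fin d) :
    roundNbr (K := K) f (c, t) = shared K q c ∪ cluster K c (f t) := by
  ext ⟨c', p | p⟩ <;> simp [roundNbr, shared, cluster]

/-- The bound of `OnlineInstance.card_matched_le` in each copy of the gadget. -/
theorem card_shared_matched_le (hf : Monotone f) {k : ℕ}
    (hk : ∀ j ≠ 0, (Finset.univ.filter fun t => f t = j).card = k) (c : Fin d)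
    (θ : unitInterval) (y : Fin (roundInstance K f).n → unitInterval) :
    (idx f (shared K q c) ∩ ((roundInstance K f).rankingMatching y).image Prod.snd).card ≤
      (Finset.univ.filter fun t => f t = 0).card +
      (if (Finset.univ.filter fun t => f t = 0).card <
        (lowRank θ y (idx f (shared K q c ∪ cluster K c 0))).card then d else 0) +
      ∑ j ∈ Finset.univ.erase 0,
        if (lowRank θ y (idx f (cluster K c j))).card < k then k else 0 := by
  classical
  have h := (roundInstance K f).card_matched_le y θ (0 : Fin (q + 1)) (k := k)
    (W := idx f (shared K q c)) (C := fun j => idx f (cluster K c j)) (T := round K f c)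
    ?_ ?_ ?_ ?_ ?_
  · rw [card_round, sum_card_round, ← idx_union] at h
    exact h
  · intro j r hr
    obtain ⟨t, rfl, rfl⟩ := (mem_round f).1 hr
    rw [nbr_round, roundNbr_eq, idx_union]
  · intro r hr
    obtain ⟨⟨c', t⟩ | x, rfl⟩ := (reqEquiv K f).surjective r
    · have hc : c' ≠ c := by
        rintro rfl
        exact hr (f t) ((mem_round f).2 ⟨t, rfl, rfl⟩)
      rw [nbr_round, disjoint_idx, Finset.disjoint_left]
      rintro ⟨c'', p | p⟩ h1 h2 <;> simp [shared, roundNbr] at h1 h2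
      exact hc (h1.trans h2.symm)
    · rw [nbr_padding, disjoint_idx, Finset.disjoint_left]
      rintro ⟨c'', p | p⟩ h1 h2 <;> simp [shared, paddingNbr] at h1 h2
  · intro j r hr r' hlt hr'
    obtain ⟨t, rfl, rfl⟩ := (mem_round f).1 hr
    obtain ⟨⟨c', t'⟩ | x, rfl⟩ := (reqEquiv K f).surjective r'
    · rw [nbr_round, disjoint_idx, Finset.disjoint_left]
      rintro ⟨c'', p | ⟨j', i⟩⟩ h1 h2 <;> simp [cluster, roundNbr] at h1 h2
      refine hr' ((mem_round f).2 ⟨t', h1.1.trans h2.1.symm, ?_⟩)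
      rw [h1.2, h2.2]
    · exact absurd hlt (round_lt_padding f _ x).not_gt
  · intro j hj r hr r' hr'
    obtain ⟨t, ht, rfl⟩ := (mem_round f).1 hr
    obtain ⟨t', ht', rfl⟩ := (mem_round f).1 hr'
    rw [round_lt_round]
    by_contra! hle
    have := hf hle
    rw [ht, ht'] at this
    exact hj (Fin.le_zero_iff.1 this)
  · intro j hj
    rw [card_round, hk j hj]

theorem n_roundInstance : (roundInstance K f).n = d * (d - K + (q + 1) * K) := by
  simp [roundInstance]

/-- The unmatched shared servers are what Ranking loses. -/
theorem card_rankingMatching_add_le (y : Fin (roundInstance K f).n → unitInterval) :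
    ((roundInstance K f).rankingMatching y).card + d * (d - K) ≤ (roundInstance K f).n +
      ∑ c : Fin d, (idx f (shared K q c) ∩
        ((roundInstance K f).rankingMatching y).image Prod.snd).card := by
  classical
  obtain ⟨-, hM⟩ := (roundInstance K f).isMatching_rankingMatching y
  set M := (roundInstance K f).rankingMatching y
  set N := M.image Prod.snd
  have h1 : M.card = N.card :=
    (Finset.card_image_of_injOn fun e he e' he' h => hM e he e' he' (.inr h)).symm
  have hdisj : (↑(Finset.univ : Finset (Fin d)) : Set (Fin d)).PairwiseDisjoint
      fun c => idx f (shared K q c) := by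
    intro c _ c' _ hcc
    change Disjoint (idx f (shared K q c)) (idx f (shared K q c'))
    rw [disjoint_idx, Finset.disjoint_left]
    rintro ⟨c'', p | p⟩ h1 h2 <;> simp [shared] at h1 h2
    exact hcc (h1.trans h2.symm)
  set B := Finset.univ.biUnion fun c => idx f (shared K q c)
  have h2 : B.card = d * (d - K) := by
    rw [Finset.card_biUnion hdisj]
    simp [card_idx, card_shared]
  have h3 : (B ∩ N).card = ∑ c, (idx f (shared K q c) ∩ N).card := by
    rw [Finset.biUnion_inter, Finset.card_biUnion]
    intro c hc c' hc' hcc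
    exact (hdisj hc hc' hcc).mono Finset.inter_subset_left Finset.inter_subset_left
  have h4 : (B ∪ N).card ≤ (roundInstance K f).n :=
    (Finset.card_le_univ _).trans_eq (Fintype.card_fin _)
  have h5 := Finset.card_union_add_card_inter B N
  omega

/-- The assignment of requests to rounds: the first `d - q * k` requests form round `0`, and each
of the `q` rounds after it consists of `k` requests. -/
def schedule (d q k : ℕ) (t : Fin d) : Fin (q + 1) :=
  Fin.ofNat (q + 1) ((t + k - (d - q * k)) / k)

theorem schedule_val {k : ℕ} (hk : 0 < k) (hqk : q * k ≤ d) (t : Fin d) :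
    (schedule d q k t : ℕ) = (t + k - (d - q * k)) / k := by
  have ht := t.2
  rw [schedule, Fin.val_ofNat, Nat.mod_eq_of_lt]
  rw [Nat.div_lt_iff_lt_mul hk, add_mul, one_mul]
  omega

theorem monotone_schedule {k : ℕ} (hk : 0 < k) (hqk : q * k ≤ d) :
    Monotone (schedule d q k) := by
  intro t t' h
  rw [Fin.le_def, schedule_val hk hqk, schedule_val hk hqk]
  exact Nat.div_le_div_right (by have := Fin.le_def.1 h; omega)

theorem card_schedule_zero {k : ℕ} (hk : 0 < k) (hqk : q * k ≤ d) :
    (Finset.univ.filter fun t => schedule d q k t = 0).card = d - q * k := by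
  have : ∀ t : Fin d, schedule d q k t = 0 ↔ (t : ℕ) < d - q * k := by
    intro t
    rw [Fin.ext_iff, schedule_val hk hqk, Fin.val_zero, Nat.div_eq_zero_iff]
    omega
  simp only [this]
  rw [Fin.card_filter_val_lt]
  omega

theorem card_schedule {k : ℕ} (hk : 0 < k) (hqk : q * k ≤ d) {j : Fin (q + 1)} (hj : j ≠ 0) :
    (Finset.univ.filter fun t => schedule d q k t = j).card = k := by
  have hj' : (j : ℕ) ≠ 0 := fun h => hj (Fin.ext h)
  obtain ⟨i, hi⟩ := Nat.exists_eq_succ_of_ne_zero hj'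
  have hiq : i + 1 ≤ q := by have := j.2; omega
  have hik : (i + 1) * k ≤ q * k := Nat.mul_le_mul_right k hiq
  rw [add_mul, one_mul] at hik
  have h : ∀ t : Fin d, schedule d q k t = j ↔
      (t : ℕ) ∈ Finset.Ico (d - q * k + i * k) (d - q * k + i * k + k) := by
    intro t
    rw [Fin.ext_iff, schedule_val hk hqk, hi, Nat.succ_eq_add_one, Nat.div_eq_iff hk,
      Finset.mem_Ico, add_mul, one_mul]
    omega
  simp only [h]
  rw [← Finset.card_map Fin.valEmbedding]
  have : (Finset.univ.filter fun t : Fin d =>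
      (t : ℕ) ∈ Finset.Ico (d - q * k + i * k) (d - q * k + i * k + k)).map Fin.valEmbedding =
      Finset.Ico (d - q * k + i * k) (d - q * k + i * k + k) := by
    ext a
    simp only [Finset.mem_map, Finset.mem_filter, Finset.mem_univ, true_and, Fin.valEmbedding_apply]
    constructor
    · rintro ⟨t, ht, rfl⟩
      exact ht
    · intro ha
      exact ⟨⟨a, by rw [Finset.mem_Ico] at ha; omega⟩, ha, rfl⟩
  rw [this, Nat.card_Ico, Nat.add_sub_cancel_left]

end RoundInstance

/-! ### The expected size of the matching -/

namespace RoundInstance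

variable {d K q : ℕ} (f : Fin d → Fin (q + 1))

/-- The bound of `card_shared_matched_le` in expectation, given bounds `p₀` and `p₁` for the
probabilities of the two kinds of bad events. -/
theorem expectedRanking_add_le (hf : Monotone f) {k : ℕ}
    (hk : ∀ j ≠ 0, (Finset.univ.filter fun t => f t = j).card = k) (θ : unitInterval) {p₀ p₁ : ℝ}
    (hp₀ : ∀ c, volume.real {y : Fin (roundInstance K f).n → unitInterval |
      (Finset.univ.filter fun t => f t = 0).card <
        (lowRank θ y (idx f (shared K q c ∪ cluster K c 0))).card} ≤ p₀)
    (hp₁ : ∀ c j, volume.real {y : Fin (roundInstance K f).n → unitInterval |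
      (lowRank θ y (idx f (cluster K c j))).card < k} ≤ p₁) :
    (roundInstance K f).expectedRanking + d * (d - K : ℕ) ≤ (roundInstance K f).n +
      d * ((Finset.univ.filter fun t => f t = 0).card + d * p₀ + q * (k * p₁)) := by
  classical
  set A : ℕ := (Finset.univ.filter fun t => f t = 0).card
  set I := roundInstance K f
  let E : Fin d → Set (Fin I.n → unitInterval) := fun c =>
    {y | A < (lowRank θ y (idx f (shared K q c ∪ cluster K c 0))).card}
  let F : Fin d → Fin (q + 1) → Set (Fin I.n → unitInterval) := fun c j =>
    {y | (lowRank θ y (idx f (cluster K c j))).card < k}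
  have hE : ∀ c, MeasurableSet (E c) := fun c => measurableSet_lowRank θ _ fun m => A < m
  have hF : ∀ c j, MeasurableSet (F c j) := fun c j => measurableSet_lowRank θ _ fun m => m < k
  have hEi : ∀ c, Integrable ((E c).indicator fun _ => (d : ℝ)) volume := fun c =>
    (integrable_const _).indicator (hE c)
  have hFi : ∀ c j, Integrable ((F c j).indicator fun _ => (k : ℝ)) volume := fun c j =>
    (integrable_const _).indicator (hF c j)
  have hFs : ∀ c, Integrable (fun y => ∑ j ∈ Finset.univ.erase 0,
      (F c j).indicator (fun _ => (k : ℝ)) y) volume := fun c =>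
    integrable_finsetSum _ fun j _ => hFi c j
  have hAE : ∀ c, Integrable (fun y => (A : ℝ) + (E c).indicator (fun _ => (d : ℝ)) y) volume :=
    fun c => (integrable_const _).add (hEi c)
  have hci : ∀ c, Integrable (fun y => (A : ℝ) + (E c).indicator (fun _ => (d : ℝ)) y +
      ∑ j ∈ Finset.univ.erase 0, (F c j).indicator (fun _ => (k : ℝ)) y) volume := fun c =>
    (hAE c).add (hFs c)
  have hpt : ∀ y : Fin I.n → unitInterval, ((I.rankingMatching y).card : ℝ) ≤
      (I.n - d * (d - K : ℕ) : ℝ) + ∑ c : Fin d, ((A : ℝ) + (E c).indicator (fun _ => (d : ℝ)) y +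
        ∑ j ∈ Finset.univ.erase 0, (F c j).indicator (fun _ => (k : ℝ)) y) := by
    intro y
    have h1 : ((I.rankingMatching y).card : ℝ) + d * (d - K : ℕ) ≤ I.n +
        ∑ c : Fin d, ((idx f (shared K q c) ∩ (I.rankingMatching y).image Prod.snd).card : ℝ) := by
      exact_mod_cast card_rankingMatching_add_le f y
    have h2 : ∑ c : Fin d, ((idx f (shared K q c) ∩
        (I.rankingMatching y).image Prod.snd).card : ℝ) ≤
        ∑ c : Fin d, ((A : ℝ) + (E c).indicator (fun _ => (d : ℝ)) y +
          ∑ j ∈ Finset.univ.erase 0, (F c j).indicator (fun _ => (k : ℝ)) y) := by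
      refine Finset.sum_le_sum fun c _ => ?_
      have h3 := card_shared_matched_le f hf hk c θ y
      simp only [Set.indicator_apply]
      simp only [E, F, Set.mem_ofPred_eq]
      exact_mod_cast h3
    linarith
  have hint : I.expectedRanking ≤ ∫ y : Fin I.n → unitInterval, ((I.n - d * (d - K : ℕ) : ℝ) +
      ∑ c : Fin d, ((A : ℝ) + (E c).indicator (fun _ => (d : ℝ)) y +
        ∑ j ∈ Finset.univ.erase 0, (F c j).indicator (fun _ => (k : ℝ)) y)) :=
    integral_mono I.integrable_ranking
      ((integrable_const _).add (integrable_finsetSum _ fun c _ => hci c)) hpt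
  have hc : ∀ c, ∫ y, ((A : ℝ) + (E c).indicator (fun _ => (d : ℝ)) y +
      ∑ j ∈ Finset.univ.erase 0, (F c j).indicator (fun _ => (k : ℝ)) y) ≤
      A + d * p₀ + q * (k * p₁) := by
    intro c
    rw [integral_add (hAE c) (hFs c),
      integral_add (integrable_const _) (hEi c), integral_finsetSum _ fun j _ => hFi c j]
    simp only [integral_indicator_const _ (hE c), integral_indicator_const _ (hF c _), smul_eq_mul,
      integral_const, probReal_univ, one_mul]
    have h1 : volume.real (E c) * d ≤ d * p₀ := by
      rw [mul_comm]
      exact mul_le_mul_of_nonneg_left (hp₀ c) (Nat.cast_nonneg d)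
    have h2 : ∑ j ∈ Finset.univ.erase 0, volume.real (F c j) * k ≤ q * (k * p₁) := by
      have h3 : ∀ j ∈ Finset.univ.erase (0 : Fin (q + 1)),
          volume.real (F c j) * k ≤ k * p₁ := fun j _ => by
        rw [mul_comm]
        exact mul_le_mul_of_nonneg_left (hp₁ c j) (Nat.cast_nonneg k)
      refine (Finset.sum_le_card_nsmul _ _ _ h3).trans (le_of_eq ?_)
      simp
    linarith
  rw [integral_add (integrable_const _) (integrable_finsetSum _ fun c _ => hci c),
    integral_finsetSum _ fun c _ => hci c, integral_const, probReal_univ, one_smul] at hint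
  have hsum := Finset.sum_le_card_nsmul Finset.univ _ _ fun c (_ : c ∈ Finset.univ) => hc c
  rw [Finset.card_univ, Fintype.card_fin, nsmul_eq_mul] at hsum
  linarith

theorem rankingCompetitiveRatio_le {d : ℕ} (hd : 100000 ≤ d) :
    rankingCompetitiveRatio d ≤ 0.8161 := by
  -- With clusters of `2000` servers and `d / 2000` later rounds of `900` requests, round `0` has at
  -- least `0.55 d` requests, so both Chebyshev bounds apply at the threshold `1/2`: in a cluster
  -- with deviation `100`, in the `d` servers adjacent to round `0` with deviation `d / 20`.
  obtain ⟨K, hK⟩ : ∃ K : ℕ, K = 2000 := ⟨_, rfl⟩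
  obtain ⟨k, hk⟩ : ∃ k : ℕ, k = 900 := ⟨_, rfl⟩
  obtain ⟨q, hq⟩ : ∃ q : ℕ, q = d / 2000 := ⟨_, rfl⟩
  have hk0 : 0 < k := by omega
  have hKd : K ≤ d := by omega
  have hqk : q * k ≤ d := by subst hk; omega
  let f := schedule d q k
  let I := roundInstance K f
  let θ : unitInterval := ⟨1 / 2, by norm_num, by norm_num⟩
  have hKR : (K : ℝ) = 2000 := by rw [hK]; norm_num
  have hkR : (k : ℝ) = 900 := by rw [hk]; norm_num
  have hdR : (100000 : ℝ) ≤ d := by exact_mod_cast hd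
  have hqdR : (q : ℝ) * 2000 ≤ d := by
    have : q * 2000 ≤ d := by omega
    exact_mod_cast this
  have hdqR : (d : ℝ) ≤ (q + 1) * 2000 := by
    have : d ≤ (q + 1) * 2000 := by omega
    exact_mod_cast this
  have hAR : ((Finset.univ.filter fun t => f t = 0).card : ℝ) = d - q * 900 := by
    rw [card_schedule_zero hk0 hqk, Nat.cast_sub hqk, Nat.cast_mul, hkR]
  have hreg : I.IsRegular d := isRegular_roundInstance f hKd
  have hn : (I.n : ℝ) = d * (d + q * 2000) := by
    rw [show I.n = _ from n_roundInstance f]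
    push_cast [Nat.cast_sub hKd]
    rw [hKR]
    ring
  have hnopt : (I.n : ℝ) ≤ I.opt := by exact_mod_cast hreg.n_le_opt (by omega)
  have hnpos : (0 : ℝ) < I.n := by rw [hn]; positivity
  have hexp := expectedRanking_add_le (K := K) f (monotone_schedule hk0 hqk) (k := k)
    (fun j hj => card_schedule hk0 hqk hj) θ (p₀ := 100 / d) (p₁ := 1 / 20)
    (fun c => by
      refine (volume_lt_lowRank_le θ _ (t := d / 20) (by positivity) ?_).trans (le_of_eq ?_)
      · rw [hAR, card_idx, card_shared_union_cluster hKd]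
        change 1 / 2 * (d : ℝ) + d / 20 ≤ d - q * 900
        linarith
      · rw [card_idx, card_shared_union_cluster hKd]
        field_simp
        norm_num)
    (fun c j => by
      refine (volume_lowRank_lt_le θ _ (t := 100) (by norm_num) ?_).trans (le_of_eq ?_)
      · rw [card_idx, card_cluster, hkR, hKR]
        change (900 : ℝ) + 100 ≤ 1 / 2 * 2000
        norm_num
      · rw [card_idx, card_cluster, hKR]
        norm_num)
  have hkey : I.expectedRanking ≤ 0.8161 * I.n := by
    change I.expectedRanking + _ ≤ (I.n : ℝ) + _ at hexp
    rw [hAR, mul_div_cancel₀ (100 : ℝ) (by positivity), Nat.cast_sub hKd, hKR, hkR] at hexp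
    have h : (d : ℝ) * (0.1839 * (d + q * 2000)) ≤
        d * ((d - 2000) - (d - q * 900 + 100 + q * (900 * (1 / 20)))) := by
      refine mul_le_mul_of_nonneg_left ?_ (by positivity)
      linarith
    rw [hn] at hexp ⊢
    linarith
  have hmem : I.expectedRanking / I.opt ∈ rankingRatios d :=
    ⟨I, hreg, by exact_mod_cast hnpos.trans_le hnopt, rfl⟩
  refine ((isGLB_rankingCompetitiveRatio (by omega)).1 hmem).trans ?_
  rw [div_le_iff₀ (hnpos.trans_le hnopt)]
  exact hkey.trans (mul_le_mul_of_nonneg_left hnopt (by norm_num))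

end RoundInstance

/-! ### The limit of `γ` -/

theorem tendsto_gamma :
    Tendsto (fun d : ℕ => 1 - ((d : ℝ) - 1) / (2 * (d : ℝ) - 1) * (1 - 1 / (d : ℝ)) ^ d)
      atTop (𝓝 (1 - 1 / (2 * Real.exp 1))) := by
  have h1 : Tendsto (fun d : ℕ => (1 - 1 / (d : ℝ)) ^ d) atTop (𝓝 (Real.exp (-1))) := by
    refine (Real.tendsto_one_add_div_pow_exp (-1)).congr fun d => ?_
    rw [neg_div, ← sub_eq_add_neg]
  have h0 : Tendsto (fun d : ℕ => 1 / (d : ℝ)) atTop (𝓝 0) := tendsto_one_div_atTop_nhds_zero_nat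
  have h2 : Tendsto (fun d : ℕ => ((d : ℝ) - 1) / (2 * (d : ℝ) - 1)) atTop (𝓝 (1 / 2)) := by
    have h3 : Tendsto (fun d : ℕ => (1 - 1 / (d : ℝ)) / (2 - 1 / (d : ℝ))) atTop
        (𝓝 ((1 - 0) / (2 - 0))) :=
      (tendsto_const_nhds.sub h0).div (tendsto_const_nhds.sub h0) (by norm_num)
    rw [sub_zero, sub_zero] at h3
    refine h3.congr' ?_
    filter_upwards [eventually_gt_atTop 0] with d hd
    have hd' : (d : ℝ) ≠ 0 := by exact_mod_cast hd.ne'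
    rw [← mul_div_mul_right _ _ hd', sub_mul, sub_mul, one_div_mul_cancel hd', one_mul]
  have h4 := (tendsto_const_nhds (x := (1 : ℝ))).sub (h2.mul h1)
  have h5 : 1 - 1 / (2 * Real.exp 1) = 1 - 1 / 2 * Real.exp (-1) := by
    rw [Real.exp_neg, ← one_div, one_div_mul_one_div]
  rw [h5]
  exact h4

theorem mainTheorem2 :
    (∃ d₀ : ℕ, ∀ d : ℕ, d₀ ≤ d → rankingCompetitiveRatio d ≤ 0.8161) ∧
      Tendsto (fun d : ℕ => 1 - ((d : ℝ) - 1) / (2 * (d : ℝ) - 1) * (1 - 1 / (d : ℝ)) ^ d)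
        atTop (𝓝 (1 - 1 / (2 * Real.exp 1))) :=
  ⟨⟨100000, fun _ hd => RoundInstance.rankingCompetitiveRatio_le hd⟩, tendsto_gamma⟩
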